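/- Let $A$ be a nonzero unital ring, let $S$ be a cancellative left Ore monoid (for all $s,t\in S$ there are $u,v\in S$ with $us=vt$) with enveloping group $G=S^{-1}S$ (a group containing $S$ in which every element has the form $s^{-1}t$ with $s,t\in S$), and let $\alpha$ be a monoid homomorphism from $S$ to the monoid of not necessarily unital ring endomorphisms of $A$, written $s\mapsto\alpha_s$, such that every $\alpha_s$ is injective. Let $R=S^{\mathrm{op}}*_\alpha A*_\alpha S$ be the unital ring with a unital ring homomorphism $\phi:A\to R$ and monoid homomorphisms $S^{\mathrm{op}}\to R$, $s\mapsto s_-$, and $S\to R$, $s\mapsto s_+$, that is universal for the relations $$s_+\phi(a)=\phi(\alpha_s(a))s_+,\quad \phi(a)s_-=s_-\phi(\alpha_s(a)),\quad s_-s_+=1,\quad s_+s_-=\phi(\alpha_s(1))\qquad(a\in A,\ s\in S).$$ It is $G$-graded by $R_g=\{s_-\phi(a)t_+ \mid a\in A,\ s,t\in S,\ s^{-1}t=g\}$. Let $S_-AS_+$ be the unital subring $\{s_-\phi(a)s_+ \mid s\in S,\ a\in A\}$ of $R$, with the action $\overline\alpha$ of $S$ by ring endomorphisms $\overline\alpha_s(x)=s_+xs_-$.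 Let $D=S^{-1}(S_-AS_+)$ be the (not necessarily unital) ring of classes $[s,b]$ of pairs $(s,b)\in S\times S_-AS_+$, where $[s_1,b_1]=[s_2,b_2]$ if and only if $t_1s_1=t_2s_2$ and $\overline\alpha_{t_1}(b_1)=\overline\alpha_{t_2}(b_2)$ for some $t_1,t_2\in S$, with operations $[s_1,b_1]+[s_2,b_2]=[t_1s_1,\overline\alpha_{t_1}(b_1)+\overline\alpha_{t_2}(b_2)]$ and $[s_1,b_1][s_2,b_2]=[t_1s_1,\overline\alpha_{t_1}(b_1)\overline\alpha_{t_2}(b_2)]$ for any $t_1,t_2\in S$ with $t_1s_1=t_2s_2$. Then the ring homomorphism $A\to D$, $a\mapsto[1,\phi(a)]$, is injective, and $\alpha$ extends along it to an action $\widehat\alpha:G\to\mathrm{Aut}(D)$, that is, $\widehat\alpha_s([1,\phi(a)])=[1,\phi(\alpha_s(a))]$ for $s\in S$ and $a\in A$; concretely, $\widehat\alpha_s([t,b])=[s',\overline\alpha_{t'}(b)]$ whenever $s,t,s',t'\in S$, $s's=t't$ and $b\in S_-AS_+$. Moreover there is a nonzero idempotent $e\in D$ such that $\widehat\alpha_s(e)\le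 e$, i.e. $\widehat\alpha_s(e)=\widehat\alpha_s(e)e=e\widehat\alpha_s(e)$, for all $s\in S$, and $$S^{\mathrm{op}}*_\alpha A*_\alpha S\;\cong\; e\bigl(D*_{\widehat\alpha}G\bigr)e$$ as $G$-graded rings. Here $D*_{\widehat\alpha}G$ is the skew group ring of finite formal sums $\sum_g d_g g$ with $(dg)(d'h)=d\,\widehat\alpha_g(d')\,gh$, the idempotent $e$ is identified with $e\cdot 1_G$, and the component of degree $g$ of the corner consists of its elements of the form $dg$ with $d\in D$. It is not assumed that $\alpha_s(A)=\alpha_s(1)A\alpha_s(1)$. -/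

import Mathlib

namespace FracSkew

/-- The left Ore condition for a monoid: any two elements have a common left multiple. -/
class IsLeftOre (S : Type*) [Monoid S] : Prop where
  exists_mul_eq_mul : ∀ s t : S, ∃ u v : S, u * s = v * t

/-- `G` together with `η : S →* G` is an enveloping group `S⁻¹S`: a group containing `S`
(through `η`) in which every element is a left fraction `s⁻¹ t` of elements of `S`. -/
structure IsEnvelopingGroup {S G : Type*} [Monoid S] [Group G] (η : S →* G) : Prop where
  injective : Function.Injective η
  exists_eq_inv_mul : ∀ g : G, ∃ s t : S, g = (η s)⁻¹ * η t

/-! ### The fractional skew monoid ring -/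

section FractionalSkewMonoidRing

/-- Generators of the fractional skew monoid ring: the elements `a` of `A`, and for each `s` in `S`
two symbols `s₋` and `s₊`. -/
inductive Gen (A S : Type*) : Type _
  | coeff (a : A) : Gen A S
  | minus (s : S) : Gen A S
  | plus (s : S) : Gen A S

open FreeRing in
/-- The defining relations: `coeff` is a unital ring homomorphism, `minus` is a monoid homomorphism
from the opposite monoid of `S`, `plus` is a monoid homomorphism from `S`, and the four
covariance relations hold. -/
inductive Rel {A S : Type*} [Ring A] [Monoid S] (α : S →* (A →ₙ+* A)) :
    FreeRing (Gen A S) → FreeRing (Gen A S) → Prop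
  | coeff_one : Rel α (of (.coeff 1)) 1
  | coeff_add (a b : A) : Rel α (of (.coeff (a + b))) (of (.coeff a) + of (.coeff b))
  | coeff_mul (a b : A) : Rel α (of (.coeff (a * b))) (of (.coeff a) * of (.coeff b))
  | minus_one : Rel α (of (.minus 1)) 1
  | minus_mul (s t : S) : Rel α (of (.minus (s * t))) (of (.minus t) * of (.minus s))
  | plus_one : Rel α (of (.plus 1)) 1
  | plus_mul (s t : S) : Rel α (of (.plus (s * t))) (of (.plus s) * of (.plus t))
  | plus_coeff (t : S) (a : A) :
      Rel α (of (.plus t) * of (.coeff a)) (of (.coeff (α t a)) * of (.plus t))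
  | coeff_minus (s : S) (a : A) :
      Rel α (of (.coeff a) * of (.minus s)) (of (.minus s) * of (.coeff (α s a)))
  | minus_plus (s : S) : Rel α (of (.minus s) * of (.plus s)) 1
  | plus_minus (s : S) : Rel α (of (.plus s) * of (.minus s)) (of (.coeff (α s 1)))

variable {A S : Type*} [Ring A] [Monoid S] (α : S →* (A →ₙ+* A))

/-- The fractional skew monoid ring `S^op *_α A *_α S`. -/
def FSMRing : Type _ := RingQuot (Rel α)

noncomputable instance : Ring (FSMRing α) := inferInstanceAs (Ring (RingQuot (Rel α)))

namespace FSMRing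

/-- The class of a generator. -/
noncomputable def gen (x : Gen A S) : FSMRing α := RingQuot.mkRingHom (Rel α) (FreeRing.of x)

/-- The canonical unital ring homomorphism `φ : A → S^op *_α A *_α S`. -/
noncomputable def coeff : A →+* FSMRing α where
  toFun a := gen α (.coeff a)
  map_one' := (RingQuot.mkRingHom_rel .coeff_one).trans (map_one _)
  map_mul' a b := (RingQuot.mkRingHom_rel (.coeff_mul a b)).trans (map_mul _ _ _)
  map_zero' := by
    have h : gen α (.coeff (0 + 0)) = gen α (.coeff 0) + gen α (.coeff 0) :=
      (RingQuot.mkRingHom_rel (.coeff_add 0 0)).trans (map_add _ _ _)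
    rw [add_zero] at h
    exact left_eq_add.mp h
  map_add' a b := (RingQuot.mkRingHom_rel (.coeff_add a b)).trans (map_add _ _ _)

/-- The canonical monoid homomorphism `s ↦ s₋` on the opposite monoid of `S`. -/
noncomputable def minus : Sᵐᵒᵖ →* FSMRing α where
  toFun s := gen α (.minus s.unop)
  map_one' := (RingQuot.mkRingHom_rel .minus_one).trans (map_one _)
  map_mul' s t := (RingQuot.mkRingHom_rel (.minus_mul t.unop s.unop)).trans (map_mul _ _ _)

/-- The canonical monoid homomorphism `s ↦ s₊`. -/
noncomputable def plus : S →* FSMRing α where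
  toFun s := gen α (.plus s)
  map_one' := (RingQuot.mkRingHom_rel .plus_one).trans (map_one _)
  map_mul' s t := (RingQuot.mkRingHom_rel (.plus_mul s t)).trans (map_mul _ _ _)

open MulOpposite (op)

theorem minus_mul (s t : S) : minus α (op (s * t)) = minus α (op t) * minus α (op s) :=
  map_mul (minus α) (op t) (op s)

theorem plus_coeff (t : S) (a : A) :
    plus α t * coeff α a = coeff α (α t a) * plus α t :=
  (map_mul _ _ _).symm.trans ((RingQuot.mkRingHom_rel (.plus_coeff t a)).trans (map_mul _ _ _))

theorem coeff_minus (s : S) (a : A) :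
    coeff α a * minus α (op s) = minus α (op s) * coeff α (α s a) :=
  (map_mul _ _ _).symm.trans ((RingQuot.mkRingHom_rel (.coeff_minus s a)).trans (map_mul _ _ _))

theorem minus_plus (s : S) : minus α (op s) * plus α s = 1 :=
  (map_mul _ _ _).symm.trans ((RingQuot.mkRingHom_rel (.minus_plus s)).trans (map_one _))

theorem plus_minus (s : S) : plus α s * minus α (op s) = coeff α (α s 1) :=
  (map_mul _ _ _).symm.trans (RingQuot.mkRingHom_rel (.plus_minus s))

/-- The universal property of the fractional skew monoid ring. -/
theorem existsUnique_lift {R : Type*} [Ring R] (φ : A →+* R) (m : Sᵐᵒᵖ →* R) (p : S →* R)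
    (h₁ : ∀ t a, p t * φ a = φ (α t a) * p t)
    (h₂ : ∀ s a, φ a * m (op s) = m (op s) * φ (α s a))
    (h₃ : ∀ s, m (op s) * p s = 1) (h₄ : ∀ s, p s * m (op s) = φ (α s 1)) :
    ∃! f : FSMRing α →+* R,
      (∀ a, f (coeff α a) = φ a) ∧ (∀ s, f (minus α s) = m s) ∧ (∀ s, f (plus α s) = p s) := by
  let g : Gen A S → R := fun x => match x with
    | .coeff a => φ a
    | .minus s => m (op s)
    | .plus s => p s
  have hg : ∀ ⦃x y⦄, Rel α x y → FreeRing.lift g x = FreeRing.lift g y := by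
    intro x y h
    induction h <;> simp [g, FreeRing.lift_of, h₁, h₂, h₃, h₄]
  refine ⟨RingQuot.lift ⟨FreeRing.lift g, hg⟩, ⟨?_, ?_, ?_⟩, ?_⟩
  · intro a
    exact (RingQuot.lift_mkRingHom_apply _ hg _).trans (FreeRing.lift_of _ _)
  · intro s
    exact (RingQuot.lift_mkRingHom_apply _ hg _).trans (FreeRing.lift_of _ _)
  · intro s
    exact (RingQuot.lift_mkRingHom_apply _ hg _).trans (FreeRing.lift_of _ _)
  · rintro f ⟨hc, hm, hp⟩
    refine RingQuot.lift_unique _ hg f (FreeRing.hom_ext fun x => ?_)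
    rw [FreeRing.lift_of]
    cases x with
    | coeff a => exact hc a
    | minus s => exact hm (op s)
    | plus s => exact hp s

/-! Auxiliary computations with common left multiples. -/

theorem plus_mul_coeff_one (s : S) : coeff α (α s 1) * plus α s = plus α s := by
  rw [← plus_coeff, map_one, mul_one]

theorem minus_mul_coeff_one (s : S) : minus α (op s) * coeff α (α s 1) = minus α (op s) := by
  rw [← coeff_minus, map_one, one_mul]

theorem expand (u s t : S) (a : A) :
    minus α (op s) * coeff α a * plus α t =
      minus α (op (u * s)) * coeff α (α u a) * plus α (u * t) := by
  calc minus α (op s) * coeff α a * plus α t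
      = minus α (op s) * coeff α a * (minus α (op u) * plus α u) * plus α t := by
        rw [minus_plus, mul_one]
    _ = minus α (op s) * (coeff α a * minus α (op u)) * (plus α u * plus α t) := by
        simp only [mul_assoc]
    _ = _ := by
        rw [coeff_minus, minus_mul, map_mul]; simp only [mul_assoc]

theorem plus_mul_minus {s t u v : S} (h : u * s = v * t) :
    plus α t * minus α (op s) = minus α (op v) * plus α u * coeff α (α s 1) := by
  calc plus α t * minus α (op s)
      = minus α (op v) * (plus α v * plus α t) * minus α (op s) := by
        rw [← mul_assoc, minus_plus, one_mul]
    _ = minus α (op v) * plus α u * (plus α s * minus α (op s)) := by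
        rw [← map_mul, ← h, map_mul]; simp only [mul_assoc]
    _ = _ := by rw [plus_minus]

theorem plus_mul_minus' {s t u v : S} (h : u * s = v * t) :
    plus α t * minus α (op s) = coeff α (α t 1) * minus α (op v) * plus α u := by
  calc plus α t * minus α (op s)
      = plus α t * (minus α (op s) * minus α (op u)) * plus α u := by
        rw [mul_assoc, mul_assoc, minus_plus, mul_one]
    _ = (plus α t * minus α (op t)) * minus α (op v) * plus α u := by
        rw [← minus_mul, h, minus_mul]; simp only [mul_assoc]
    _ = _ := by rw [plus_minus]

end FSMRing

open MulOpposite (op)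
open FSMRing

/-- The unital subring `S₋ A S₊ = {s₋ a s₊ | s ∈ S, a ∈ A}` of `S^op *_α A *_α S`. -/
noncomputable def dilationSubring [IsLeftOre S] : Subring (FSMRing α) where
  carrier := {x | ∃ (s : S) (a : A), x = minus α (op s) * coeff α a * plus α s}
  one_mem' := ⟨1, 1, by simp⟩
  zero_mem' := ⟨1, 0, by simp⟩
  neg_mem' := by
    rintro _ ⟨s, a, rfl⟩
    exact ⟨s, -a, by simp⟩
  add_mem' := by
    rintro _ _ ⟨s, a, rfl⟩ ⟨t, b, rfl⟩
    obtain ⟨u, v, h⟩ := IsLeftOre.exists_mul_eq_mul s t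
    refine ⟨u * s, α u a + α v b, ?_⟩
    rw [expand α u s s, expand α v t t, ← h, map_add, mul_add, add_mul]
  mul_mem' := by
    rintro _ _ ⟨t, a, rfl⟩ ⟨s, b, rfl⟩
    obtain ⟨u, v, h⟩ := IsLeftOre.exists_mul_eq_mul s t
    refine ⟨u * s, α v a * α u (α s 1 * b), ?_⟩
    calc minus α (op t) * coeff α a * plus α t * (minus α (op s) * coeff α b * plus α s)
        = minus α (op t) * coeff α a * (plus α t * minus α (op s)) * coeff α b * plus α s := by
          simp only [mul_assoc]
      _ = minus α (op t) * (coeff α a * minus α (op v)) *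
            (plus α u * coeff α (α s 1 * b)) * plus α s := by
          rw [plus_mul_minus α h, map_mul]; simp only [mul_assoc]
      _ = (minus α (op t) * minus α (op v)) * (coeff α (α v a) * coeff α (α u (α s 1 * b))) *
            (plus α u * plus α s) := by
          rw [coeff_minus, plus_coeff]; simp only [mul_assoc]
      _ = _ := by rw [← minus_mul, ← h, map_mul (coeff α), map_mul (plus α)]

theorem conj_mem [IsLeftOre S] (s : S) {x : FSMRing α} (hx : x ∈ dilationSubring α) :
    plus α s * x * minus α (op s) ∈ dilationSubring α := by
  obtain ⟨t, a, rfl⟩ := hx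
  obtain ⟨u, v, h⟩ := IsLeftOre.exists_mul_eq_mul s t
  refine ⟨u, α v (α t 1 * a * α t 1), ?_⟩
  calc plus α s * (minus α (op t) * coeff α a * plus α t) * minus α (op s)
      = (plus α s * minus α (op t)) * coeff α a * (plus α t * minus α (op s)) := by
        simp only [mul_assoc]
    _ = minus α (op u) * (plus α v * coeff α (α t 1 * a * α t 1)) * minus α (op v) * plus α u := by
        rw [plus_mul_minus α h.symm, plus_mul_minus' α h, map_mul, map_mul]
        simp only [mul_assoc]
    _ = minus α (op u) * coeff α (α v (α t 1 * a * α t 1)) *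
          (plus α v * minus α (op v)) * plus α u := by
        rw [plus_coeff]; simp only [mul_assoc]
    _ = _ := by
        rw [plus_minus, mul_assoc (minus α (op u)), ← map_mul (coeff α), ← map_mul (α v), mul_one]

/-- The action `ᾱ` of `S` on `S₋ A S₊` by (not necessarily unital) ring endomorphisms,
`ᾱ_s (x) = s₊ x s₋`. -/
noncomputable def dilationAction [IsLeftOre S] :
    S →* (dilationSubring α →ₙ+* dilationSubring α) where
  toFun s :=
    { toFun x := ⟨plus α s * x.1 * minus α (op s), conj_mem α s x.2⟩
      map_zero' := Subtype.ext (by simp)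
      map_add' x y := Subtype.ext (by simp [mul_add, add_mul])
      map_mul' x y := Subtype.ext (by
        change plus α s * (x.1 * y.1) * minus α (op s) =
          (plus α s * x.1 * minus α (op s)) * (plus α s * y.1 * minus α (op s))
        calc _ = plus α s * x.1 * 1 * y.1 * minus α (op s) := by simp only [mul_assoc, one_mul]
          _ = _ := by rw [← minus_plus α s]; simp only [mul_assoc]) }
  map_one' := NonUnitalRingHom.ext fun x => Subtype.ext (by
    change plus α 1 * x.1 * minus α (op 1) = x.1
    simp)
  map_mul' s t := NonUnitalRingHom.ext fun x => Subtype.ext (by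
    change plus α (s * t) * x.1 * minus α (op (s * t)) =
      plus α s * (plus α t * x.1 * minus α (op t)) * minus α (op s)
    rw [map_mul, minus_mul]; simp only [mul_assoc])

variable {G : Type*} [Group G] (η : S →* G)

/-- The homogeneous component of `S^op *_α A *_α S` of degree `g ∈ G`: the set of all
`s₋ a t₊` with `s⁻¹ t = g` and `a ∈ A`. -/
noncomputable def component [IsLeftOre S] (hη : IsEnvelopingGroup η) (g : G) :
    AddSubgroup (FSMRing α) where
  carrier := {x | ∃ (s t : S) (a : A),
    (η s)⁻¹ * η t = g ∧ x = minus α (op s) * coeff α a * plus α t}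
  zero_mem' := by
    obtain ⟨s, t, h⟩ := hη.exists_eq_inv_mul g
    exact ⟨s, t, 0, h.symm, by simp⟩
  neg_mem' := by
    rintro _ ⟨s, t, a, h, rfl⟩
    exact ⟨s, t, -a, h, by simp⟩
  add_mem' := by
    rintro _ _ ⟨s, t, a, h, rfl⟩ ⟨s', t', b, h', rfl⟩
    obtain ⟨u, v, hs⟩ := IsLeftOre.exists_mul_eq_mul s s'
    have ht : u * t = v * t' := by
      apply hη.injective
      have e1 : η t = η s * g := by rw [← h, mul_inv_cancel_left]
      have e2 : η t' = η s' * g := by rw [← h', mul_inv_cancel_left]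
      rw [map_mul, map_mul, e1, e2, ← mul_assoc, ← mul_assoc, ← map_mul, ← map_mul, hs]
    refine ⟨u * s, u * t, α u a + α v b, ?_, ?_⟩
    · rw [← h]; simp [mul_assoc]
    · rw [expand α u s t, expand α v s' t', ← hs, ← ht, map_add, mul_add, add_mul]

end FractionalSkewMonoidRing

/-! ### The localized ring `S⁻¹B` -/

section Localized

variable {B S : Type*} [NonUnitalRing B] [Monoid S] (β : S →* (B →ₙ+* B))

theorem act_act (u v : S) (b : B) : β u (β v b) = β (u * v) b := by
  rw [map_mul]; rfl

/-- The relation `(s₁, b₁) ∼ (s₂, b₂)` on `S × B`: there are `t₁, t₂ ∈ S` with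
`t₁ s₁ = t₂ s₂` and `β_{t₁}(b₁) = β_{t₂}(b₂)`. -/
def locSetoid [IsLeftOre S] : Setoid (S × B) where
  r x y := ∃ t₁ t₂ : S, t₁ * x.1 = t₂ * y.1 ∧ β t₁ x.2 = β t₂ y.2
  iseqv :=
    { refl := fun x => ⟨1, 1, rfl, rfl⟩
      symm := fun ⟨t₁, t₂, h, h'⟩ => ⟨t₂, t₁, h.symm, h'.symm⟩
      trans := by
        rintro x y z ⟨t₁, t₂, h, h'⟩ ⟨u₁, u₂, k, k'⟩
        obtain ⟨v, w, e⟩ := IsLeftOre.exists_mul_eq_mul t₂ u₁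
        refine ⟨v * t₁, w * u₂, ?_, ?_⟩
        · rw [mul_assoc, h, ← mul_assoc, e, mul_assoc, k, ← mul_assoc]
        · rw [← act_act, h', act_act, e, ← act_act, k', act_act] }

/-- The set `S⁻¹B` of equivalence classes `[s, b]`. -/
def Loc [IsLeftOre S] : Type _ := Quotient (locSetoid β)

namespace Loc

section

variable [IsLeftOre S]

/-- The class `[s, b]`. -/
def mk (s : S) (b : B) : Loc β := Quotient.mk (locSetoid β) (s, b)

theorem mk_eq_mk {s t : S} {a b : B} :
    mk β s a = mk β t b ↔ ∃ u v : S, u * s = v * t ∧ β u a = β v b :=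
  ⟨fun h => Quotient.exact h, fun h => Quotient.sound h⟩

theorem mk_expand (u s : S) (b : B) : mk β s b = mk β (u * s) (β u b) :=
  (mk_eq_mk β).2 ⟨u, 1, by simp, by simp⟩

instance : Zero (Loc β) := ⟨mk β 1 0⟩

instance : Neg (Loc β) :=
  ⟨Quotient.lift (fun x => mk β x.1 (-x.2)) fun x y ⟨u, v, h, k⟩ =>
    (mk_eq_mk β).2 ⟨u, v, h, by rw [map_neg, map_neg, k]⟩⟩

theorem neg_mk (s : S) (a : B) : -mk β s a = mk β s (-a) := rfl

theorem zero_eq (s : S) : (0 : Loc β) = mk β s 0 :=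
  (mk_eq_mk β).2 ⟨s, 1, by simp, by simp⟩

theorem exists_mk₃ (x y z : Loc β) :
    ∃ (s : S) (a b c : B), x = mk β s a ∧ y = mk β s b ∧ z = mk β s c := by
  obtain ⟨⟨s, a⟩, rfl⟩ := Quotient.exists_rep x
  obtain ⟨⟨t, b⟩, rfl⟩ := Quotient.exists_rep y
  obtain ⟨⟨r, c⟩, rfl⟩ := Quotient.exists_rep z
  obtain ⟨u, v, h⟩ := IsLeftOre.exists_mul_eq_mul s t
  obtain ⟨w, q, k⟩ := IsLeftOre.exists_mul_eq_mul (u * s) r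
  refine ⟨w * (u * s), β (w * u) a, β (w * v) b, β q c, ?_, ?_, ?_⟩
  · rw [← mul_assoc]; exact mk_expand β _ _ _
  · rw [h, ← mul_assoc]; exact mk_expand β _ _ _
  · rw [k]; exact mk_expand β _ _ _

end

variable [IsCancelMul S] [IsLeftOre S]

theorem op_aux (f : B → B → B) (hf : ∀ t a b, β t (f a b) = f (β t a) (β t b))
    {s t s' t' u v u' v' : S} {a b a' b' : B}
    (h : u * s = v * t) (h' : u' * s' = v' * t')
    (hx : mk β s a = mk β s' a') (hy : mk β t b = mk β t' b') :
    mk β (u * s) (f (β u a) (β v b)) = mk β (u' * s') (f (β u' a') (β v' b')) := by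
  obtain ⟨x, x', e, ea⟩ := (mk_eq_mk β).1 hx
  obtain ⟨y, y', k, kb⟩ := (mk_eq_mk β).1 hy
  obtain ⟨c₁, c₂, hc⟩ := IsLeftOre.exists_mul_eq_mul (u * s) (u' * s')
  obtain ⟨d₁, d₂, hd⟩ := IsLeftOre.exists_mul_eq_mul (x * s) (y * t)
  obtain ⟨m, n, hm⟩ := IsLeftOre.exists_mul_eq_mul (c₁ * (u * s)) (d₁ * (x * s))
  have e1 : m * c₁ * u = n * d₁ * x := by
    apply mul_right_cancel (b := s); simpa only [mul_assoc] using hm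
  have e2 : m * c₂ * u' = n * d₁ * x' := by
    apply mul_right_cancel (b := s')
    rw [mul_assoc _ u', mul_assoc m, ← hc, hm, e]; simp only [mul_assoc]
  have e3 : m * c₁ * v = n * d₂ * y := by
    apply mul_right_cancel (b := t)
    rw [mul_assoc _ v, mul_assoc m, ← h, hm, hd]; simp only [mul_assoc]
  have e4 : m * c₂ * v' = n * d₂ * y' := by
    apply mul_right_cancel (b := t')
    rw [mul_assoc _ v', mul_assoc m, ← h', ← hc, hm, hd, k]; simp only [mul_assoc]
  refine (mk_eq_mk β).2 ⟨m * c₁, m * c₂, ?_, ?_⟩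
  · rw [mul_assoc, hc, mul_assoc]
  · rw [hf, hf, act_act, act_act, act_act, act_act, e1, e2, e3, e4, ← act_act, ea, act_act,
      ← act_act _ _ y, kb, act_act]

/-- The binary operation on `S⁻¹B` given by
`[s₁, b₁], [s₂, b₂] ↦ [t₁ s₁, f (β_{t₁}(b₁), β_{t₂}(b₂))]` where `t₁ s₁ = t₂ s₂`; it does not depend
on the choices (see `map₂_mk`). -/
noncomputable def map₂ (f : B → B → B) (hf : ∀ t a b, β t (f a b) = f (β t a) (β t b)) :
    Loc β → Loc β → Loc β :=
  Quotient.lift₂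
    (fun x y => mk β ((IsLeftOre.exists_mul_eq_mul x.1 y.1).choose * x.1)
      (f (β (IsLeftOre.exists_mul_eq_mul x.1 y.1).choose x.2)
        (β (IsLeftOre.exists_mul_eq_mul x.1 y.1).choose_spec.choose y.2)))
    (fun x y x' y' hx hy => op_aux β f hf
      (IsLeftOre.exists_mul_eq_mul x.1 y.1).choose_spec.choose_spec
      (IsLeftOre.exists_mul_eq_mul x'.1 y'.1).choose_spec.choose_spec
      (Quotient.sound hx) (Quotient.sound hy))

theorem map₂_mk (f : B → B → B) (hf : ∀ t a b, β t (f a b) = f (β t a) (β t b))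
    {s t u v : S} (h : u * s = v * t) (a b : B) :
    map₂ β f hf (mk β s a) (mk β t b) = mk β (u * s) (f (β u a) (β v b)) :=
  op_aux β f hf (IsLeftOre.exists_mul_eq_mul s t).choose_spec.choose_spec h rfl rfl

noncomputable instance : Add (Loc β) := ⟨map₂ β (· + ·) fun t a b => map_add (β t) a b⟩

noncomputable instance : Mul (Loc β) := ⟨map₂ β (· * ·) fun t a b => map_mul (β t) a b⟩

theorem mk_add_mk {s t u v : S} (h : u * s = v * t) (a b : B) :
    mk β s a + mk β t b = mk β (u * s) (β u a + β v b) := map₂_mk β _ _ h a b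

theorem mk_mul_mk {s t u v : S} (h : u * s = v * t) (a b : B) :
    mk β s a * mk β t b = mk β (u * s) (β u a * β v b) := map₂_mk β _ _ h a b

theorem add_mk (s : S) (a b : B) : mk β s a + mk β s b = mk β s (a + b) := by
  rw [mk_add_mk β (u := 1) (v := 1) rfl]; simp

theorem mul_mk (s : S) (a b : B) : mk β s a * mk β s b = mk β s (a * b) := by
  rw [mk_mul_mk β (u := 1) (v := 1) rfl]; simp

noncomputable instance : NonUnitalRing (Loc β) where
  add_assoc x y z := by
    obtain ⟨s, a, b, c, rfl, rfl, rfl⟩ := exists_mk₃ β x y z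
    simp only [add_mk, add_assoc]
  zero_add x := by
    obtain ⟨s, a, -, -, rfl, -, -⟩ := exists_mk₃ β x x x
    rw [zero_eq β s, add_mk, zero_add]
  add_zero x := by
    obtain ⟨s, a, -, -, rfl, -, -⟩ := exists_mk₃ β x x x
    rw [zero_eq β s, add_mk, add_zero]
  add_comm x y := by
    obtain ⟨s, a, b, -, rfl, rfl, -⟩ := exists_mk₃ β x y y
    simp only [add_mk, add_comm]
  neg_add_cancel x := by
    obtain ⟨s, a, -, -, rfl, -, -⟩ := exists_mk₃ β x x x
    rw [neg_mk, add_mk, neg_add_cancel, ← zero_eq]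
  mul_assoc x y z := by
    obtain ⟨s, a, b, c, rfl, rfl, rfl⟩ := exists_mk₃ β x y z
    simp only [mul_mk, mul_assoc]
  zero_mul x := by
    obtain ⟨s, a, -, -, rfl, -, -⟩ := exists_mk₃ β x x x
    rw [zero_eq β s, mul_mk, zero_mul]
  mul_zero x := by
    obtain ⟨s, a, -, -, rfl, -, -⟩ := exists_mk₃ β x x x
    rw [zero_eq β s, mul_mk, mul_zero]
  left_distrib x y z := by
    obtain ⟨s, a, b, c, rfl, rfl, rfl⟩ := exists_mk₃ β x y z
    simp only [add_mk, mul_mk, mul_add]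
  right_distrib x y z := by
    obtain ⟨s, a, b, c, rfl, rfl, rfl⟩ := exists_mk₃ β x y z
    simp only [add_mk, mul_mk, add_mul]
  nsmul := nsmulRec
  zsmul := zsmulRec

end Loc

/-- The natural map `A → S⁻¹(S₋ A S₊)`, `a ↦ [1, a]`. -/
noncomputable def embed {A S : Type*} [Ring A] [Monoid S] [IsCancelMul S] [IsLeftOre S]
    (α : S →* (A →ₙ+* A)) : A →ₙ+* Loc (dilationAction α) where
  toFun a := Loc.mk (dilationAction α) 1 ⟨FSMRing.coeff α a, 1, a, by simp⟩
  map_zero' := (congrArg (Loc.mk (dilationAction α) 1) (Subtype.ext (by simp))).trans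
    (Loc.zero_eq (dilationAction α) 1).symm
  map_add' a b := (congrArg (Loc.mk (dilationAction α) 1) (Subtype.ext (by simp))).trans
    (Loc.add_mk (dilationAction α) 1 _ _).symm
  map_mul' a b := (congrArg (Loc.mk (dilationAction α) 1) (Subtype.ext (by simp))).trans
    (Loc.mul_mk (dilationAction α) 1 _ _).symm

end Localized

/-! ### Skew group rings over rings without unit -/

section SkewGroupRing

variable {D G : Type*} [NonUnitalRing D] [Group G] (γ : G →* RingAut D)

/-- The skew group ring `D *_γ G`: finitely supported sums `∑ d_g g`, with multiplication determined
by `(d g) (d' h) = d γ_g(d') gh`. -/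
def SkewGroupRing (_ : G →* RingAut D) : Type _ := G →₀ D

namespace SkewGroupRing

noncomputable instance : AddCommGroup (SkewGroupRing γ) := inferInstanceAs (AddCommGroup (G →₀ D))

/-- The monomial `d g`. -/
noncomputable def single (g : G) : D →+ SkewGroupRing γ :=
  (Finsupp.singleAddHom g : D →+ (G →₀ D))

theorem addHom_ext {M : Type*} [AddZeroClass M] {f f' : SkewGroupRing γ →+ M}
    (h : ∀ g d, f (single γ g d) = f' (single γ g d)) : f = f' :=
  Finsupp.addHom_ext (M := D) h

/-- Additive maps out of `D *_γ G` are given by their values on monomials. -/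
noncomputable def liftAdd {M : Type*} [AddCommMonoid M] (f : G → D →+ M) :
    SkewGroupRing γ →+ M :=
  (Finsupp.liftAddHom (M := D) f : (G →₀ D) →+ M)

theorem liftAdd_single {M : Type*} [AddCommMonoid M] (f : G → D →+ M) (g : G) (d : D) :
    liftAdd γ f (single γ g d) = f g d :=
  Finsupp.liftAddHom_apply_single (M := D) f g d

/-- The multiplication, as a biadditive map. -/
noncomputable def mulHom : SkewGroupRing γ →+ SkewGroupRing γ →+ SkewGroupRing γ :=
  liftAdd γ fun g => AddMonoidHom.flip (liftAdd γ fun h => AddMonoidHom.flip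
    ((AddMonoidHom.mul.compl₂ ((γ g : D ≃+* D) : D →+ D)).compr₂ (single γ (g * h))))

noncomputable instance : Mul (SkewGroupRing γ) := ⟨fun x y => mulHom γ x y⟩

theorem mulHom_single (g h : G) (a b : D) :
    mulHom γ (single γ g a) (single γ h b) = single γ (g * h) (a * γ g b) := by
  rw [mulHom, liftAdd_single, AddMonoidHom.flip_apply, liftAdd_single]
  rfl

theorem single_mul_single (g h : G) (a b : D) :
    single γ g a * single γ h b = single γ (g * h) (a * γ g b) :=
  mulHom_single γ g h a b

noncomputable instance : NonUnitalRing (SkewGroupRing γ) where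
  left_distrib x y z := map_add (mulHom γ x) y z
  right_distrib x y z := DFunLike.congr_fun (map_add (mulHom γ) x y) z
  zero_mul x := DFunLike.congr_fun (map_zero (mulHom γ)) x
  mul_zero x := map_zero (mulHom γ x)
  mul_assoc x y z := by
    let L : SkewGroupRing γ →+ SkewGroupRing γ →+ SkewGroupRing γ →+ SkewGroupRing γ :=
      (mulHom γ).compr₂ (mulHom γ)
    let R : SkewGroupRing γ →+ SkewGroupRing γ →+ SkewGroupRing γ →+ SkewGroupRing γ :=
      (AddMonoidHom.compHom.flip (mulHom γ)).comp (AddMonoidHom.compHom.comp (mulHom γ))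
    have key : L = R := by
      refine addHom_ext γ fun g a => addHom_ext γ fun h b => addHom_ext γ fun k c => ?_
      change mulHom γ (mulHom γ (single γ g a) (single γ h b)) (single γ k c) =
        mulHom γ (single γ g a) (mulHom γ (single γ h b) (single γ k c))
      simp only [mulHom_single, mul_assoc, map_mul, RingAut.mul_apply]
    exact DFunLike.congr_fun (DFunLike.congr_fun (DFunLike.congr_fun key x) y) z

/-- An idempotent `e` of `D`, seen in degree `1`, is an idempotent of `D *_γ G`. -/
theorem isIdempotentElem_single {e : D} (he : IsIdempotentElem e) :
    IsIdempotentElem (single γ 1 e) := by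
  have h : (γ 1 : RingAut D) e = e := by rw [map_one]; rfl
  rw [IsIdempotentElem, single_mul_single, h, he.eq, one_mul]

/-- The homogeneous component of degree `g` of the corner `e (D *_γ G) e`: its elements that are of
the form `d g` with `d ∈ D`. -/
noncomputable def cornerComponent {e : D} (he : IsIdempotentElem e) (g : G) :
    AddSubgroup (isIdempotentElem_single γ he).Corner where
  carrier := {x | ∃ d : D, x.1 = single γ g d}
  zero_mem' := ⟨0, (map_zero (single γ g)).symm⟩
  neg_mem' := by
    rintro x ⟨d, h⟩
    refine ⟨-d, ?_⟩
    rw [map_neg, ← h]; rfl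
  add_mem' := by
    rintro x y ⟨d, h⟩ ⟨d', h'⟩
    refine ⟨d + d', ?_⟩
    rw [map_add, ← h, ← h']; rfl

end SkewGroupRing

end SkewGroupRing

/-- A family of additive subgroups of a unital ring, indexed by a group `G`, is a `G`-grading:
`R` is their internal direct sum, `1 ∈ R_1` and `R_g R_h ⊆ R_{gh}`. -/
structure IsGrading {R G : Type*} [Ring R] [Group G] (C : G → AddSubgroup R) : Prop where
  one_mem : (1 : R) ∈ C 1
  mul_mem : ∀ {g h : G} {x y : R}, x ∈ C g → y ∈ C h → x * y ∈ C (g * h)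
  iSupIndep : iSupIndep C
  iSup_eq_top : ⨆ g, C g = ⊤

/-- Two rings with additive subgroups indexed by `G` are isomorphic as `G`-graded rings: both
families are gradings, and some ring isomorphism maps each component onto the component
of the same degree. -/
def GradedIsomorphic {R R' G : Type*} [Ring R] [Ring R'] [Group G]
    (C : G → AddSubgroup R) (C' : G → AddSubgroup R') : Prop :=
  IsGrading C ∧ IsGrading C' ∧
    ∃ Φ : R ≃+* R', ∀ g : G, ∀ x : R, x ∈ C g ↔ Φ x ∈ C' g

end FracSkew

namespace FracSkew

/-! ### Extending monoid homomorphisms to the enveloping group -/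

section Extend

variable {S G H : Type*} [Monoid S] [Group G] [Group H] {η : S →* G}

/-! On `D`, each `s : S` gives a map `[t, b] ↦ [t s, b]`; cancellation makes it injective and the
Ore condition surjective. Its inverse extends `ᾱ_s`, so `S` acts on `D` by automorphisms, and the
action passes to left fractions, hence to `G`.

Write `ι` for `a ↦ [1, φ(a)]` and take `e = ι(1)`. The comparison with the corner
(`gradedIsomorphic_corner`) uses three facts only: `ι` is injective, `γ_s ι = ι α_s`, and every `d ∈
D` is carried into `ι(A)` by some `s ∈ S`. The universal property gives a homomorphism `a ↦ ι(a)`,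
`s₊ ↦ e s e`, `s₋ ↦ e s⁻¹ e` into the corner. It sends `s₋ a t₊` to a monomial whose coefficient is
`γ_s⁻¹(ι(α_s(1) a α_t(1)))`. Since `s₋ a t₊` depends only on `α_s(1) a α_t(1)`, the map is injective
on each component; the third fact makes it onto each component. Coordinates in the corner then give
both global injectivity and the independence of the components of the fractional skew monoid ring.

Injectivity of `φ` comes from the same homomorphism, built over the auxiliary ring `S⁻¹A` in place
of `D`: there `φ(a)` goes to `[1, a]`, and `a ↦ [1, a]` is injective because all `α_s` are. -/

theorem inv_mul_map_eq [IsLeftOre S] (hη : IsEnvelopingGroup η) (f : S →* H) {s t s' t' : S}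
    (h : (η s)⁻¹ * η t = (η s')⁻¹ * η t') : (f s)⁻¹ * f t = (f s')⁻¹ * f t' := by
  obtain ⟨u, v, hs⟩ := IsLeftOre.exists_mul_eq_mul s s'
  -- Equal fractions in `G`: multipliers that equalise the denominators also equalise the
  -- numerators.
  have ht : u * t = v * t' := by
    apply hη.injective
    have e1 : η t = η s * ((η s')⁻¹ * η t') := by rw [← h, mul_inv_cancel_left]
    rw [map_mul, e1, ← mul_assoc, ← map_mul, hs, map_mul, map_mul]
    group
  calc (f s)⁻¹ * f t = (f (u * s))⁻¹ * f (u * t) := by rw [map_mul, map_mul]; group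
    _ = _ := by rw [hs, ht, map_mul, map_mul]; group

/-- The Ore relation turns `f t * (f s')⁻¹` into `(f u)⁻¹ * f v`. Using the same `u`, `v` for `f`
and for `η` yields multiplicativity of the extension. -/
theorem fraction_mul_fraction (f : S →* H) {t s' u v : S} (e : u * t = v * s') (s t' : S) :
    (f s)⁻¹ * f t * ((f s')⁻¹ * f t') = (f (u * s))⁻¹ * f (v * t') := by
  have e' : f t = (f u)⁻¹ * (f v * f s') := by
    rw [← map_mul, ← e, map_mul, inv_mul_cancel_left]
  rw [e', map_mul, map_mul]
  group

/-- The extension to the enveloping group of a monoid homomorphism into a group. -/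
noncomputable def extendHom [IsLeftOre S] (hη : IsEnvelopingGroup η) (f : S →* H) : G →* H where
  toFun g := (f (hη.exists_eq_inv_mul g).choose)⁻¹ *
    f (hη.exists_eq_inv_mul g).choose_spec.choose
  map_one' := by
    have h := (hη.exists_eq_inv_mul (1 : G)).choose_spec.choose_spec
    rw [inv_mul_map_eq hη f (s' := 1) (t' := 1) (by rw [← h]; simp)]
    simp
  map_mul' g k := by
    have h := (hη.exists_eq_inv_mul g).choose_spec.choose_spec
    have h' := (hη.exists_eq_inv_mul k).choose_spec.choose_spec
    have h'' := (hη.exists_eq_inv_mul (g * k)).choose_spec.choose_spec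
    generalize (hη.exists_eq_inv_mul g).choose_spec.choose = t at h ⊢
    generalize (hη.exists_eq_inv_mul g).choose = s at h ⊢
    generalize (hη.exists_eq_inv_mul k).choose_spec.choose = t' at h' ⊢
    generalize (hη.exists_eq_inv_mul k).choose = s' at h' ⊢
    obtain ⟨u, v, e⟩ := IsLeftOre.exists_mul_eq_mul t s'
    rw [fraction_mul_fraction f e]
    refine inv_mul_map_eq hη f ?_
    rw [← h'', ← fraction_mul_fraction η e, ← h, ← h']

theorem extendHom_apply [IsLeftOre S] (hη : IsEnvelopingGroup η) (f : S →* H) (s : S) :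
    extendHom hη f (η s) = f s := by
  have h := (hη.exists_eq_inv_mul (η s)).choose_spec.choose_spec
  change (f _)⁻¹ * f _ = f s
  rw [inv_mul_map_eq hη f (s' := 1) (t' := s) (by rw [← h]; simp)]
  simp

end Extend

/-! ### The action of the enveloping group on the localized ring -/

namespace Loc

section

variable {B S : Type*} [NonUnitalRing B] [Monoid S] [IsCancelMul S] [IsLeftOre S]
  (β : S →* (B →ₙ+* B))

/-- The automorphism `[t, b] ↦ [t s, b]` of `S⁻¹B`. -/
noncomputable def scale (s : S) : RingAut (Loc β) :=
  RingEquiv.ofBijective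
    (⟨⟨Quotient.lift (fun x => mk β (x.1 * s) x.2) fun x y ⟨u, v, h, k⟩ =>
      (mk_eq_mk β).2 ⟨u, v, by rw [← mul_assoc, h, mul_assoc], k⟩,
      fun x y => by
        obtain ⟨t, a, b, -, rfl, rfl, -⟩ := exists_mk₃ β x y y
        rw [mul_mk]
        exact (mul_mk β (t * s) a b).symm⟩,
      (zero_eq β (1 * s)).symm,
      fun x y => by
        obtain ⟨t, a, b, -, rfl, rfl, -⟩ := exists_mk₃ β x y y
        rw [add_mk]
        exact (add_mk β (t * s) a b).symm⟩ : Loc β →ₙ+* Loc β)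
    ⟨fun x y h => by
      obtain ⟨t, a, b, -, rfl, rfl, -⟩ := exists_mk₃ β x y y
      obtain ⟨u, v, h, k⟩ := (mk_eq_mk β).1 h
      rw [← mul_assoc, ← mul_assoc] at h
      exact (mk_eq_mk β).2 ⟨u, v, mul_right_cancel h, k⟩,
    fun x => by
      obtain ⟨t, b, -, -, rfl, -, -⟩ := exists_mk₃ β x x x
      obtain ⟨u, v, h⟩ := IsLeftOre.exists_mul_eq_mul s t
      -- `[t, b] = [v t, β_v(b)] = [u s, β_v(b)]`.
      refine ⟨mk β u (β v b), ?_⟩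
      rw [mk_expand β v t b, ← h]
      rfl⟩

theorem scale_mk (s t : S) (b : B) : scale β s (mk β t b) = mk β (t * s) b := rfl

/-- The action of `S` on `S⁻¹B` by automorphisms, inverse to `scale`. -/
noncomputable def invScale : S →* RingAut (Loc β) where
  toFun s := (scale β s)⁻¹
  map_one' := by
    rw [inv_eq_one]
    ext x
    obtain ⟨t, b, -, -, rfl, -, -⟩ := exists_mk₃ β x x x
    rw [scale_mk, mul_one]
    rfl
  map_mul' s s' := by
    -- `scale` reverses products, since it multiplies denominators on the right; its inverse
    -- therefore preserves them.
    rw [← mul_inv_rev, inv_inj]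
    ext x
    obtain ⟨t, b, -, -, rfl, -, -⟩ := exists_mk₃ β x x x
    rw [RingAut.mul_apply, scale_mk, scale_mk, scale_mk, mul_assoc]

variable {G : Type*} [Group G] {η : S →* G} (hη : IsEnvelopingGroup η)

/-- The action of the enveloping group `G` on `S⁻¹B` extending the action `β` of `S` on `B`. -/
noncomputable def action : G →* RingAut (Loc β) := extendHom hη (invScale β)

theorem action_inv_mk (s t : S) (b : B) :
    action β hη (η s)⁻¹ (mk β t b) = mk β (t * s) b := by
  rw [map_inv, action, extendHom_apply]
  change (scale β s)⁻¹⁻¹ (mk β t b) = _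
  rw [inv_inv, scale_mk]

/-- After expanding `[t, b]` to `[u s, β_v(b)]`, acting by `s` cancels the right factor `s` of the
denominator. -/
theorem action_mk {s t u v : S} (h : u * s = v * t) (b : B) :
    action β hη (η s) (mk β t b) = mk β u (β v b) := by
  rw [mk_expand β v t b, ← h, ← action_inv_mk β hη, ← RingAut.mul_apply, ← map_mul, mul_inv_cancel,
    map_one]
  rfl

theorem mk_injective (hβ : ∀ s, Function.Injective (β s)) (s : S) :
    Function.Injective (mk β s) := by
  intro a b h
  obtain ⟨u, v, h, k⟩ := (mk_eq_mk β).1 h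
  rw [mul_right_cancel h] at k
  exact hβ v k

/-- The natural map `B → S⁻¹B`, `b ↦ [1, b]`. -/
noncomputable def ofHom : B →ₙ+* Loc β where
  toFun := mk β 1
  map_zero' := (zero_eq β 1).symm
  map_add' a b := (add_mk β 1 a b).symm
  map_mul' a b := (mul_mk β 1 a b).symm

theorem action_ofHom (s : S) (b : B) : action β hη (η s) (ofHom β b) = ofHom β (β s b) :=
  action_mk β hη (by rw [one_mul, mul_one]) b

end

end Loc

/-! ### Gradings and coordinate maps -/

section Gradings

variable {M N G : Type*} [AddCommGroup M] [AddCommGroup N] {C : G → AddSubgroup M}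
  {π : G → M →+ N}

/-- The sum of the components other than `C g` lies in the kernel of `π g`, which meets `C g`
trivially. The values lie in an arbitrary group `N`, so coordinates may be read off in another ring.
-/
theorem iSupIndep_of_coord (h₀ : ∀ g h x, h ≠ g → x ∈ C h → π g x = 0)
    (h₁ : ∀ g x, x ∈ C g → π g x = 0 → x = 0) : iSupIndep C := by
  intro g
  rw [disjoint_iff_inf_le]
  rintro x ⟨hx, hx'⟩
  have hle : (⨆ h, ⨆ (_ : h ≠ g), C h) ≤ (π g).ker :=
    iSup₂_le fun h hne y hy => h₀ g h y hne hy
  exact h₁ g x hx (hle hx')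

theorem exists_finsupp_sum {x : M} (hx : x ∈ ⨆ g, C g) :
    ∃ f : G →₀ M, (∀ g, f g ∈ C g) ∧ (f.sum fun _ y => y) = x := by
  classical
  refine AddSubgroup.iSup_induction C (C := fun x => ∃ f : G →₀ M, (∀ g, f g ∈ C g) ∧
    (f.sum fun _ y => y) = x) hx ?_ ?_ ?_
  · intro g y hy
    refine ⟨Finsupp.single g y, fun h => ?_, by simp⟩
    by_cases e : g = h
    · subst e; simpa using hy
    · rw [Finsupp.single_eq_of_ne (Ne.symm e)]; exact zero_mem _
  · exact ⟨0, fun g => zero_mem _, by simp⟩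
  · rintro _ _ ⟨f, hf, rfl⟩ ⟨f', hf', rfl⟩
    exact ⟨f + f', fun g => add_mem (hf g) (hf' g),
      Finsupp.sum_add_index' (fun _ => rfl) fun _ _ _ => rfl⟩

/-- In a decomposition of `x` into homogeneous terms, `π g` sees only the term of degree `g`. This
passes from injectivity on components to injectivity on the whole. -/
theorem eq_zero_of_coord (hC : ⨆ g, C g = ⊤) (h₀ : ∀ g h x, h ≠ g → x ∈ C h → π g x = 0)
    (h₁ : ∀ g x, x ∈ C g → π g x = 0 → x = 0) {x : M} (hx : ∀ g, π g x = 0) : x = 0 := by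
  obtain ⟨f, hf, rfl⟩ := exists_finsupp_sum (C := C) (x := x) (by rw [hC]; trivial)
  refine Finset.sum_eq_zero fun g hg => h₁ g _ (hf g) ?_
  have := hx g
  rwa [Finsupp.sum, map_sum, Finset.sum_eq_single g (fun h _ hne => h₀ g h _ hne (hf h))
    (fun h => absurd hg h)] at this

end Gradings

/-! ### The grading of the fractional skew monoid ring -/

namespace FSMRing

open MulOpposite (op)

variable {A S : Type*} [Ring A] [Monoid S] (α : S →* (A →ₙ+* A))

/-- The inner product `t₊ s'₋` equals `v₋ u₊ α_{s'}(1)`; then `v₋` moves left past `a` and `u₊`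
right past `α_{s'}(1) b`. -/
theorem monomial_mul_monomial {t s' u v : S} (h : u * s' = v * t) (s t' : S) (a b : A) :
    minus α (op s) * coeff α a * plus α t * (minus α (op s') * coeff α b * plus α t') =
      minus α (op (v * s)) * coeff α (α v a * α u (α s' 1 * b)) * plus α (u * t') := by
  calc _ = minus α (op s) * coeff α a * (plus α t * minus α (op s')) * coeff α b * plus α t' := by
        simp only [mul_assoc]
    _ = minus α (op s) * (coeff α a * minus α (op v)) *
          (plus α u * coeff α (α s' 1 * b)) * plus α t' := by
        rw [plus_mul_minus α h, map_mul]; simp only [mul_assoc]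
    _ = (minus α (op s) * minus α (op v)) * (coeff α (α v a) * coeff α (α u (α s' 1 * b))) *
          (plus α u * plus α t') := by
        rw [coeff_minus, plus_coeff]; simp only [mul_assoc]
    _ = _ := by rw [← minus_mul, map_mul (coeff α), map_mul (plus α)]

/-- `s₋` absorbs `α_s(1)` on its right and `t₊` absorbs `α_t(1)` on its left. -/
theorem monomial_eq (s t : S) (a : A) :
    minus α (op s) * coeff α a * plus α t =
      minus α (op s) * coeff α (α s 1 * a * α t 1) * plus α t := by
  rw [map_mul, map_mul, ← mul_assoc (minus α (op s)), ← mul_assoc (minus α (op s)),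
    minus_mul_coeff_one, mul_assoc _ (coeff α (α t 1)), plus_mul_coeff_one]

theorem conj_monomial {s : S} (a : A) :
    plus α s * (minus α (op s) * coeff α a * plus α s) * minus α (op s) =
      coeff α (α s 1 * a * α s 1) := by
  calc _ = (plus α s * minus α (op s)) * coeff α a * (plus α s * minus α (op s)) := by
        simp only [mul_assoc]
    _ = _ := by rw [plus_minus, map_mul, map_mul]

theorem conj_coeff (s : S) (a : A) :
    plus α s * coeff α a * minus α (op s) = coeff α (α s a) := by
  rw [plus_coeff, mul_assoc, plus_minus, ← map_mul, ← map_mul, mul_one]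

variable {G : Type*} [Group G] {η : S →* G} [IsLeftOre S] (hη : IsEnvelopingGroup η)

theorem monomial_mem_component (s t : S) (a : A) :
    minus α (op s) * coeff α a * plus α t ∈ component α η hη ((η s)⁻¹ * η t) :=
  ⟨s, t, a, rfl, rfl⟩

theorem component_one_mem : (1 : FSMRing α) ∈ component α η hη 1 :=
  ⟨1, 1, 1, by simp, by simp⟩

theorem component_mul_mem {g h : G} {x y : FSMRing α} (hx : x ∈ component α η hη g)
    (hy : y ∈ component α η hη h) : x * y ∈ component α η hη (g * h) := by
  obtain ⟨s, t, a, rfl, rfl⟩ := hx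
  obtain ⟨s', t', b, rfl, rfl⟩ := hy
  obtain ⟨u, v, e⟩ := IsLeftOre.exists_mul_eq_mul s' t
  rw [monomial_mul_monomial α e]
  refine ⟨_, _, _, ?_, rfl⟩
  have e' : η t = (η v)⁻¹ * (η u * η s') := by
    rw [← map_mul, e, map_mul, inv_mul_cancel_left]
  rw [e', map_mul, map_mul]
  group

/-- The sum of the components contains `1` and all generators and is closed under products. -/
theorem iSup_component : ⨆ g, component α η hη g = ⊤ := by
  rw [eq_top_iff]
  intro x _
  obtain ⟨z, rfl⟩ := RingQuot.mkRingHom_surjective (Rel α) x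
  have hone : (1 : FSMRing α) ∈ ⨆ g, component α η hη g :=
    AddSubgroup.mem_iSup_of_mem 1 (component_one_mem α hη)
  have hmul : ∀ x y : FSMRing α, x ∈ ⨆ g, component α η hη g → y ∈ ⨆ g, component α η hη g →
      x * y ∈ ⨆ g, component α η hη g := by
    intro x y hx hy
    refine AddSubgroup.iSup_induction _ (C := fun x => x * y ∈ ⨆ g, component α η hη g) hx
      (fun g x hx => ?_) ?_ fun x x' hx hx' => ?_
    · refine AddSubgroup.iSup_induction _ (C := fun y => x * y ∈ ⨆ g, component α η hη g) hy
        (fun h y hy => ?_) ?_ fun y y' hy hy' => ?_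
      · exact AddSubgroup.mem_iSup_of_mem _ (component_mul_mem α hη hx hy)
      · rw [mul_zero]; exact zero_mem _
      · rw [mul_add]; exact add_mem hy hy'
    · rw [zero_mul]; exact zero_mem _
    · rw [add_mul]; exact add_mem hx hx'
  induction z using FreeRing.induction_on with
  | hn1 => rw [map_neg, map_one]; exact neg_mem hone
  | ha x y hx hy => rw [map_add]; exact add_mem (hx trivial) (hy trivial)
  | hm x y hx hy => rw [map_mul]; exact hmul _ _ (hx trivial) (hy trivial)
  | hb b =>
    cases b with
    | coeff a =>
      have := monomial_mem_component α hη 1 1 a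
      rw [show op (1 : S) = 1 from rfl, map_one (minus α), one_mul, map_one (plus α), mul_one] at this
      exact AddSubgroup.mem_iSup_of_mem _ this
    | minus s =>
      have := monomial_mem_component α hη s 1 1
      rw [map_one (coeff α), map_one (plus α), mul_one, mul_one] at this
      exact AddSubgroup.mem_iSup_of_mem _ this
    | plus s =>
      have := monomial_mem_component α hη 1 s 1
      rw [show op (1 : S) = 1 from rfl, map_one (minus α), one_mul, map_one (coeff α), one_mul] at this
      exact AddSubgroup.mem_iSup_of_mem _ this

end FSMRing

/-! ### The grading of the corner of the skew group ring. -/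

namespace SkewGroupRing

variable {D G : Type*} [NonUnitalRing D] [Group G] (γ : G →* RingAut D)

/-- The coefficient at `g`. -/
noncomputable def coord (g : G) : SkewGroupRing γ →+ D :=
  (Finsupp.applyAddHom g : (G →₀ D) →+ D)

theorem coord_single_self (g : G) (d : D) : coord γ g (single γ g d) = d :=
  Finsupp.single_eq_same (M := D)

theorem coord_single_of_ne {g h : G} (hne : h ≠ g) (d : D) : coord γ g (single γ h d) = 0 :=
  Finsupp.single_eq_of_ne (M := D) hne.symm

theorem map_one_apply (d : D) : γ 1 d = d := by rw [map_one]; rfl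

theorem map_mul_apply (g h : G) (d : D) : γ (g * h) d = γ g (γ h d) := by rw [map_mul]; rfl

theorem map_inv_apply_self (g : G) (d : D) : γ g⁻¹ (γ g d) = d := by
  rw [← map_mul_apply, inv_mul_cancel, map_one_apply]

theorem single_injective (g : G) : Function.Injective (single γ g) :=
  Finsupp.single_injective (M := D) g

variable {γ}
variable {e : D} (he : IsIdempotentElem e)

theorem corner_ext {x y : (isIdempotentElem_single γ he).Corner} (h : x.1 = y.1) : x = y :=
  Subtype.ext h

theorem corner_single {x : (isIdempotentElem_single γ he).Corner} {g : G} {d : D}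
    (h : x.1 = single γ g d) : e * d = d ∧ d * γ g e = d := by
  obtain ⟨h₁, h₂⟩ := (Subsemigroup.mem_corner_iff (isIdempotentElem_single γ he)).1 x.2
  rw [h, single_mul_single, map_one_apply, one_mul] at h₁
  rw [h, single_mul_single, mul_one] at h₂
  exact ⟨single_injective γ g h₁, single_injective γ g h₂⟩

/-- The monomial `d g`, as an element of the corner. -/
noncomputable def cornerSingle (g : G) (d : D) (h₁ : e * d = d) (h₂ : d * γ g e = d) :
    (isIdempotentElem_single γ he).Corner :=
  ⟨single γ g d, (Subsemigroup.mem_corner_iff (isIdempotentElem_single γ he)).2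
    ⟨by rw [single_mul_single, map_one_apply, one_mul, h₁],
      by rw [single_mul_single, mul_one, h₂]⟩⟩

/-- The compression `x ↦ e x e` onto the corner. -/
noncomputable def compress : SkewGroupRing γ →+ (isIdempotentElem_single γ he).Corner where
  toFun x := ⟨single γ 1 e * x * single γ 1 e, x, rfl⟩
  map_zero' := corner_ext he (by
    change single γ 1 e * 0 * single γ 1 e = 0
    rw [mul_zero, zero_mul])
  map_add' x y := corner_ext he (by
    change single γ 1 e * (x + y) * single γ 1 e =
      single γ 1 e * x * single γ 1 e + single γ 1 e * y * single γ 1 e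
    rw [mul_add, add_mul])

theorem compress_single_mem (g : G) (d : D) :
    compress he (single γ g d) ∈ cornerComponent γ he g :=
  ⟨e * d * γ g e, by
    change single γ 1 e * single γ g d * single γ 1 e = _
    rw [single_mul_single, single_mul_single, map_one_apply, one_mul, mul_one]⟩

theorem compress_coe (x : (isIdempotentElem_single γ he).Corner) : compress he x.1 = x := by
  obtain ⟨h₁, h₂⟩ := (Subsemigroup.mem_corner_iff (isIdempotentElem_single γ he)).1 x.2
  apply corner_ext he
  change single γ 1 e * x.1 * single γ 1 e = x.1
  rw [h₁, h₂]

/-- Compression fixes the corner and sends monomials to monomials of the same degree, so a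
decomposition in the whole skew group ring compresses to one in the corner. -/
theorem iSup_cornerComponent : ⨆ g, cornerComponent γ he g = ⊤ := by
  rw [eq_top_iff]
  intro x _
  rw [← compress_coe he x]
  refine Finsupp.induction_linear (M := D)
    (motive := fun y => compress he (y : SkewGroupRing γ) ∈ ⨆ g, cornerComponent γ he g)
    x.1 ?_ ?_ ?_
  · exact (map_zero (compress (γ := γ) he)).symm ▸ zero_mem _
  · intro y z hy hz
    exact (map_add (compress (γ := γ) he) y z).symm ▸ add_mem hy hz
  · intro g d
    exact AddSubgroup.mem_iSup_of_mem g (compress_single_mem he g d)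

/-- The coefficient at `g` of an element of the corner. -/
noncomputable def cornerCoord (g : G) : (isIdempotentElem_single γ he).Corner →+ D where
  toFun x := coord γ g x.1
  map_zero' := map_zero (coord γ g)
  map_add' x y := map_add (coord γ g) x.1 y.1

theorem cornerCoord_of_ne (g h : G) (x : (isIdempotentElem_single γ he).Corner) (hne : h ≠ g)
    (hx : x ∈ cornerComponent γ he h) : cornerCoord he g x = 0 := by
  obtain ⟨d, hd⟩ := hx
  change coord γ g x.1 = 0
  rw [hd, coord_single_of_ne γ hne]

theorem eq_zero_of_cornerCoord (g : G) (x : (isIdempotentElem_single γ he).Corner)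
    (hx : x ∈ cornerComponent γ he g) (h : cornerCoord he g x = 0) : x = 0 := by
  obtain ⟨d, hd⟩ := hx
  change coord γ g x.1 = 0 at h
  rw [hd, coord_single_self] at h
  apply corner_ext he
  rw [hd, h, map_zero]
  rfl

theorem isGrading_cornerComponent : IsGrading (cornerComponent γ he) where
  one_mem := ⟨e, rfl⟩
  mul_mem := by
    rintro g h x y ⟨d, hd⟩ ⟨d', hd'⟩
    refine ⟨d * γ g d', ?_⟩
    change x.1 * y.1 = _
    rw [hd, hd', single_mul_single]
  iSupIndep := iSupIndep_of_coord (cornerCoord_of_ne he) (eq_zero_of_cornerCoord he)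
  iSup_eq_top := iSup_cornerComponent he

end SkewGroupRing

/-! ### The homomorphism to the corner ring -/

section CornerHom

open MulOpposite (op)
open SkewGroupRing

variable {A S D G : Type*} [Ring A] [Monoid S] [NonUnitalRing D] [Group G]
  {α : S →* (A →ₙ+* A)} {η : S →* G} {γ : G →* RingAut D} {ι : A →ₙ+* D}

theorem isIdempotentElem_map_one (ι : A →ₙ+* D) : IsIdempotentElem (ι 1) := by
  rw [IsIdempotentElem, ← map_mul, mul_one]

theorem inv_apply_map (hι : ∀ s a, γ (η s) (ι a) = ι (α s a)) (s : S) (a : A) :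
    γ (η s)⁻¹ (ι (α s a)) = ι a := by
  rw [← hι, map_inv_apply_self]

theorem map_one_mul_inv_apply (hι : ∀ s a, γ (η s) (ι a) = ι (α s a)) (s : S) (a : A) :
    ι 1 * γ (η s)⁻¹ (ι a) = γ (η s)⁻¹ (ι (α s 1 * a)) := by
  rw [map_mul, map_mul, inv_apply_map hι]

/-- `A` as a subring of the component of degree one of the corner. -/
noncomputable def cornerCoeff (γ : G →* RingAut D) (ι : A →ₙ+* D) :
    A →+* (isIdempotentElem_single γ (isIdempotentElem_map_one ι)).Corner where
  toFun a := cornerSingle (isIdempotentElem_map_one ι) 1 (ι a) (by rw [← map_mul, one_mul])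
    (by rw [map_one_apply, ← map_mul, mul_one])
  map_one' := rfl
  map_mul' a b := corner_ext (isIdempotentElem_map_one ι) (by
    change single γ 1 (ι (a * b)) = single γ 1 (ι a) * single γ 1 (ι b)
    rw [single_mul_single, map_one_apply, map_mul, one_mul])
  map_zero' := corner_ext (isIdempotentElem_map_one ι) (by
    change single γ 1 (ι 0) = 0
    rw [map_zero, map_zero])
  map_add' a b := corner_ext (isIdempotentElem_map_one ι) (by
    change single γ 1 (ι (a + b)) = single γ 1 (ι a) + single γ 1 (ι b)
    rw [map_add, map_add])

variable (hι : ∀ s a, γ (η s) (ι a) = ι (α s a))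

/-- The elements `ι(1) s ι(1)` of the corner. -/
noncomputable def cornerPlus :
    S →* (isIdempotentElem_single γ (isIdempotentElem_map_one ι)).Corner where
  toFun s := cornerSingle (isIdempotentElem_map_one ι) (η s) (ι (α s 1)) (by rw [← map_mul, one_mul])
    (by rw [hι, ← map_mul, ← map_mul, mul_one])
  map_one' := corner_ext (isIdempotentElem_map_one ι) (by
    change single γ (η 1) (ι (α 1 1)) = single γ 1 (ι 1)
    rw [map_one η, map_one α]; rfl)
  map_mul' s t := corner_ext (isIdempotentElem_map_one ι) (by
    change single γ (η (s * t)) (ι (α (s * t) 1)) =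
      single γ (η s) (ι (α s 1)) * single γ (η t) (ι (α t 1))
    rw [single_mul_single, hι, ← map_mul η, ← map_mul ι, ← map_mul (α s), one_mul, map_mul α]; rfl)

/-- The elements `ι(1) s⁻¹ ι(1)` of the corner. -/
noncomputable def cornerMinus :
    Sᵐᵒᵖ →* (isIdempotentElem_single γ (isIdempotentElem_map_one ι)).Corner where
  -- The coefficient of `e s⁻¹ e` is `e γ_s⁻¹(e)`, which is just `e = ι(1)` because `γ_s(e) ≤ e`.
  toFun s := cornerSingle (isIdempotentElem_map_one ι) (η s.unop)⁻¹ (ι 1) (isIdempotentElem_map_one ι) (by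
    rw [map_one_mul_inv_apply hι, mul_one, inv_apply_map hι])
  map_one' := corner_ext (isIdempotentElem_map_one ι) (by
    change single γ (η 1)⁻¹ (ι 1) = single γ 1 (ι 1)
    rw [map_one, inv_one])
  map_mul' s t := corner_ext (isIdempotentElem_map_one ι) (by
    change single γ (η (t.unop * s.unop))⁻¹ (ι 1) =
      single γ (η s.unop)⁻¹ (ι 1) * single γ (η t.unop)⁻¹ (ι 1)
    rw [single_mul_single, map_mul, mul_inv_rev, map_one_mul_inv_apply hι, mul_one,
      inv_apply_map hι])

theorem existsUnique_cornerHom :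
    ∃! f : FSMRing α →+* (isIdempotentElem_single γ (isIdempotentElem_map_one ι)).Corner,
      (∀ a, f (FSMRing.coeff α a) = cornerCoeff γ ι a) ∧
      (∀ s, f (FSMRing.minus α s) = cornerMinus hι s) ∧
      (∀ s, f (FSMRing.plus α s) = cornerPlus hι s) := by
  refine FSMRing.existsUnique_lift α (cornerCoeff γ ι) (cornerMinus hι) (cornerPlus hι)
    (fun s a => corner_ext (isIdempotentElem_map_one ι) ?_)
    (fun s a => corner_ext (isIdempotentElem_map_one ι) ?_)
    (fun s => corner_ext (isIdempotentElem_map_one ι) ?_)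
    fun s => corner_ext (isIdempotentElem_map_one ι) ?_
  · change single γ (η s) (ι (α s 1)) * single γ 1 (ι a) =
      single γ 1 (ι (α s a)) * single γ (η s) (ι (α s 1))
    rw [single_mul_single, single_mul_single, hι, map_one_apply, ← map_mul, ← map_mul, ← map_mul,
      ← map_mul, one_mul, mul_one, one_mul, mul_one]
  · change single γ 1 (ι a) * single γ (η s)⁻¹ (ι 1) =
      single γ (η s)⁻¹ (ι 1) * single γ 1 (ι (α s a))
    rw [single_mul_single, single_mul_single, inv_apply_map hι, map_one_apply, ← map_mul,
      ← map_mul, one_mul, mul_one, one_mul, mul_one]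
  · change single γ (η s)⁻¹ (ι 1) * single γ (η s) (ι (α s 1)) = single γ 1 (ι 1)
    rw [single_mul_single, inv_apply_map hι, ← map_mul, mul_one, inv_mul_cancel]
  · change single γ (η s) (ι (α s 1)) * single γ (η s)⁻¹ (ι 1) = single γ 1 (ι (α s 1))
    rw [single_mul_single, hι, ← map_mul, ← map_mul, mul_one, mul_inv_cancel]

/-- The homomorphism from the fractional skew monoid ring to the corner of the skew group ring. -/
noncomputable def cornerHom :
    FSMRing α →+* (isIdempotentElem_single γ (isIdempotentElem_map_one ι)).Corner :=
  (existsUnique_cornerHom hι).choose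

theorem cornerHom_coeff (a : A) : cornerHom hι (FSMRing.coeff α a) = cornerCoeff γ ι a :=
  (existsUnique_cornerHom hι).choose_spec.1.1 a

theorem cornerHom_monomial (s t : S) (a : A) :
    (cornerHom hι (FSMRing.minus α (op s) * FSMRing.coeff α a * FSMRing.plus α t)).1 =
      single γ ((η s)⁻¹ * η t) (γ (η s)⁻¹ (ι (α s 1 * a * α t 1))) := by
  rw [map_mul, map_mul, cornerHom_coeff]
  unfold cornerHom
  rw [(existsUnique_cornerHom hι).choose_spec.1.2.1, (existsUnique_cornerHom hι).choose_spec.1.2.2]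
  change single γ (η s)⁻¹ (ι 1) * single γ 1 (ι a) * single γ (η t) (ι (α t 1)) = _
  rw [single_mul_single, single_mul_single, mul_one, map_one_mul_inv_apply hι, ← map_mul (γ _),
    ← map_mul ι]

variable [IsLeftOre S] (hη : IsEnvelopingGroup η)

theorem cornerHom_mem {g : G} {x : FSMRing α} (hx : x ∈ component α η hη g) :
    cornerHom hι x ∈ cornerComponent γ (isIdempotentElem_map_one ι) g := by
  obtain ⟨s, t, a, rfl, rfl⟩ := hx
  exact ⟨_, cornerHom_monomial hι s t a⟩

/-- A vanishing image forces `α_s(1) a α_t(1) = 0`, and by `monomial_eq` this element may replace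
`a`. -/
theorem eq_zero_of_cornerHom (hinj : Function.Injective ι) {g : G} {x : FSMRing α}
    (hx : x ∈ component α η hη g) (h : cornerHom hι x = 0) : x = 0 := by
  obtain ⟨s, t, a, rfl, rfl⟩ := hx
  have h' := cornerHom_monomial hι s t a
  rw [h] at h'
  have h₂ : single γ ((η s)⁻¹ * η t) (γ (η s)⁻¹ (ι (α s 1 * a * α t 1))) =
      single γ ((η s)⁻¹ * η t) 0 := h'.symm.trans (map_zero _).symm
  have h₃ := single_injective γ _ h₂
  rw [EmbeddingLike.map_eq_zero_iff] at h₃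
  have h₄ : α s 1 * a * α t 1 = 0 := hinj (h₃.trans (map_zero ι).symm)
  rw [FSMRing.monomial_eq, h₄, map_zero, mul_zero, zero_mul]

/-- Given `d g` with `g = s⁻¹ t`, some `r` carries `d` into `ι(A)`. A common left multiple `u r = v
s` serves both as denominator of `g` and as an element carrying `d` into `ι(A)`. -/
theorem cornerHom_surjOn (hD : ∀ d : D, ∃ s a, γ (η s) d = ι a) {g : G}
    {y : (isIdempotentElem_single γ (isIdempotentElem_map_one ι)).Corner}
    (hy : y ∈ cornerComponent γ (isIdempotentElem_map_one ι) g) :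
    ∃ x ∈ component α η hη g, cornerHom hι x = y := by
  obtain ⟨d, hd⟩ := hy
  obtain ⟨hd₁, hd₂⟩ := corner_single (isIdempotentElem_map_one ι) hd
  obtain ⟨r, a, hr⟩ := hD d
  obtain ⟨s, t, rfl⟩ := hη.exists_eq_inv_mul g
  obtain ⟨u, v, h⟩ := IsLeftOre.exists_mul_eq_mul r s
  have hg : (η s)⁻¹ * η t = (η (u * r))⁻¹ * η (v * t) := by
    rw [h, map_mul, map_mul]; group
  have ha : γ (η (u * r)) d = ι (α u a) := by
    rw [map_mul, map_mul_apply, hr, hι]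
  refine ⟨FSMRing.minus α (op (u * r)) * FSMRing.coeff α (α u a) * FSMRing.plus α (v * t),
    ⟨_, _, _, hg.symm, rfl⟩, corner_ext (isIdempotentElem_map_one ι) ?_⟩
  -- As `(u r) g = v t` in `G`, the left side is `γ_{ur}(e d γ_g(e))`, and `e d γ_g(e) = d` in the
  -- corner.
  have key : ι (α (u * r) 1 * α u a * α (v * t) 1) = γ (η (u * r)) d := by
    rw [map_mul, map_mul, ← hι (u * r), ← hι (v * t), ← ha, ← map_mul, hd₁]
    conv_rhs => rw [← hd₂, map_mul, ← map_mul_apply, hg, mul_inv_cancel_left]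
  rw [cornerHom_monomial, hd, hg, key, map_inv_apply_self]

theorem gradedIsomorphic_corner (hι : ∀ s a, γ (η s) (ι a) = ι (α s a)) (hinj : Function.Injective ι)
    (hD : ∀ d : D, ∃ s a, γ (η s) d = ι a) :
    GradedIsomorphic (component α η hη)
      (cornerComponent γ (isIdempotentElem_map_one ι)) := by
  -- Coordinates are taken after mapping to the corner, so independence of the source components is
  -- not needed beforehand.
  let π (g : G) := (cornerCoord (γ := γ) (isIdempotentElem_map_one ι) g).comp
    (cornerHom hι).toAddMonoidHom
  have h₀ : ∀ g h x, h ≠ g → x ∈ component α η hη h → π g x = 0 := fun g h x hne hx =>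
    cornerCoord_of_ne (isIdempotentElem_map_one ι) g h _ hne (cornerHom_mem hι hη hx)
  have h₁ : ∀ g x, x ∈ component α η hη g → π g x = 0 → x = 0 := fun g x hx h =>
    eq_zero_of_cornerHom hι hη hinj hx
      (eq_zero_of_cornerCoord (isIdempotentElem_map_one ι) g _ (cornerHom_mem hι hη hx) h)
  have hinj' : Function.Injective (cornerHom hι) := by
    rw [injective_iff_map_eq_zero]
    intro x hx
    refine eq_zero_of_coord (FSMRing.iSup_component α hη) h₀ h₁ fun g => ?_
    change cornerCoord (isIdempotentElem_map_one ι) g (cornerHom hι x) = 0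
    rw [hx, map_zero]
  have hsurj : Function.Surjective (cornerHom hι) := by
    intro y
    have hle : ⨆ g, cornerComponent γ (isIdempotentElem_map_one ι) g ≤
        (cornerHom hι).toAddMonoidHom.range := iSup_le fun g z hz => by
      obtain ⟨x, -, hx⟩ := cornerHom_surjOn hι hη hD hz
      exact ⟨x, hx⟩
    rw [iSup_cornerComponent] at hle
    exact hle (AddSubgroup.mem_top y)
  refine ⟨⟨FSMRing.component_one_mem α hη, FSMRing.component_mul_mem α hη,
    iSupIndep_of_coord h₀ h₁, FSMRing.iSup_component α hη⟩, isGrading_cornerComponent _,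
    RingEquiv.ofBijective (cornerHom hι) ⟨hinj', hsurj⟩, fun g x => ⟨cornerHom_mem hι hη,
      fun hx => ?_⟩⟩
  obtain ⟨x', hx', h⟩ := cornerHom_surjOn hι hη hD hx
  rwa [← hinj' h]

end CornerHom

/-! ### The embedding of `A` into `D` and its three properties. -/

section Embed

variable {A S G : Type*} [Ring A] [Monoid S] [IsLeftOre S] {α : S →* (A →ₙ+* A)}

/-- `z ↦ s₋ z s₊` undoes `ᾱ_s`, since `s₋ s₊ = 1`. -/
theorem dilationAction_injective (s : S) : Function.Injective (dilationAction α s) := by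
  intro x y h
  have h' : FSMRing.plus α s * x.1 * FSMRing.minus α (.op s) =
      FSMRing.plus α s * y.1 * FSMRing.minus α (.op s) := congrArg Subtype.val h
  have key : ∀ z, FSMRing.minus α (.op s) * (FSMRing.plus α s * z * FSMRing.minus α (.op s)) *
      FSMRing.plus α s = z := fun z => by
    rw [mul_assoc (FSMRing.plus α s), ← mul_assoc, FSMRing.minus_plus, one_mul, mul_assoc,
      FSMRing.minus_plus, mul_one]
  exact Subtype.ext (by rw [← key x.1, h', key])

theorem coeff_mem_dilationSubring (a : A) : FSMRing.coeff α a ∈ dilationSubring α :=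
  ⟨1, a, by simp⟩

variable [IsCancelMul S] [Group G] {η : S →* G} (hη : IsEnvelopingGroup η)

/-- The corner homomorphism is taken over `S⁻¹A`, localized by `α` itself, where injectivity of `a ↦
[1, a]` does not presuppose that of `φ`. -/
theorem coeff_injective (hη : IsEnvelopingGroup η) (hα : ∀ s, Function.Injective (α s)) :
    Function.Injective (FSMRing.coeff α) := by
  intro a b h
  have h' := congrArg (cornerHom (Loc.action_ofHom α hη)) h
  rw [cornerHom_coeff, cornerHom_coeff] at h'
  have h₂ : SkewGroupRing.single (Loc.action α hη) 1 (Loc.mk α 1 a) =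
      SkewGroupRing.single (Loc.action α hη) 1 (Loc.mk α 1 b) := congrArg Subtype.val h'
  exact Loc.mk_injective α hα 1 (SkewGroupRing.single_injective _ 1 h₂)

theorem embed_apply (a : A) : embed α a =
    Loc.mk (dilationAction α) 1 ⟨FSMRing.coeff α a, coeff_mem_dilationSubring a⟩ := rfl

theorem embed_injective (hη : IsEnvelopingGroup η) (hα : ∀ s, Function.Injective (α s)) :
    Function.Injective (embed α) := by
  intro a b h
  rw [embed_apply, embed_apply] at h
  have h₂ := Loc.mk_injective (dilationAction α) dilationAction_injective 1 h
  exact coeff_injective hη hα (Subtype.mk.inj h₂)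

theorem action_embed (s : S) (a : A) :
    Loc.action (dilationAction α) hη (η s) (embed α a) = embed α (α s a) := by
  rw [embed_apply, embed_apply,
    Loc.action_mk (dilationAction α) hη (u := 1) (v := s) (by rw [one_mul, mul_one])]
  congr 1
  exact Subtype.ext (FSMRing.conj_coeff α s a)

/-- For `d = [t, r₋ a r₊]`, acting by `t` clears the denominator, and acting by `r` then gives `r₊
r₋ a r₊ r₋ = α_r(1) a α_r(1)`, an element of `φ(A)`. -/
theorem exists_action_eq_embed (d : Loc (dilationAction α)) :
    ∃ s a, Loc.action (dilationAction α) hη (η s) d = embed α a := by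
  obtain ⟨t, ⟨_, r, a, rfl⟩, -, -, rfl, -, -⟩ := Loc.exists_mk₃ _ d d d
  refine ⟨r * t, α r 1 * a * α r 1, ?_⟩
  rw [embed_apply, Loc.action_mk (dilationAction α) hη (u := 1) (v := r) (by rw [one_mul])]
  congr 1
  exact Subtype.ext (FSMRing.conj_monomial α a)

end Embed

end FracSkew

theorem corollary3p10 {A S G : Type*} [Ring A] [Nontrivial A]
    [Monoid S] [IsCancelMul S] [FracSkew.IsLeftOre S]
    [Group G] (η : S →* G) (hη : FracSkew.IsEnvelopingGroup η)
    (α : S →* (A →ₙ+* A)) (hα : ∀ s : S, Function.Injective (α s)) :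
    Function.Injective (FracSkew.embed α) ∧
    ∃ γ : G →* RingAut (FracSkew.Loc (FracSkew.dilationAction α)),
      (∀ (s : S) (a : A), γ (η s) (FracSkew.embed α a) = FracSkew.embed α (α s a)) ∧
      (∀ (s t u v : S) (b : FracSkew.dilationSubring α), u * s = v * t →
        γ (η s) (FracSkew.Loc.mk (FracSkew.dilationAction α) t b) =
          FracSkew.Loc.mk (FracSkew.dilationAction α) u (FracSkew.dilationAction α v b)) ∧
      ∃ (e : FracSkew.Loc (FracSkew.dilationAction α)) (he : IsIdempotentElem e),
        e ≠ 0 ∧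
        (∀ s : S, γ (η s) e * e = γ (η s) e ∧ e * γ (η s) e = γ (η s) e) ∧
        FracSkew.GradedIsomorphic
          (FracSkew.component α η hη) (FracSkew.SkewGroupRing.cornerComponent γ he) := by
  have hinj := FracSkew.embed_injective hη hα
  refine ⟨hinj, FracSkew.Loc.action (FracSkew.dilationAction α) hη, FracSkew.action_embed hη,
    fun s t u v b h => FracSkew.Loc.action_mk _ hη h b, FracSkew.embed α 1,
    FracSkew.isIdempotentElem_map_one _, fun h => one_ne_zero (hinj (h.trans (map_zero _).symm)),
    fun s => ?_, FracSkew.gradedIsomorphic_corner hη (FracSkew.action_embed hη) hinj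
      (FracSkew.exists_action_eq_embed hη)⟩
  rw [FracSkew.action_embed, ← map_mul, ← map_mul, mul_one, one_mul]
  exact ⟨rfl, rfl⟩
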